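/- Let $n\ge 0$ be an integer and let $(H,\delta)$ be a sequence $$0\to H_n\xrightarrow{\delta_n} H_{n-1}\to\cdots\to H_1\xrightarrow{\delta_1} H_0\to 0$$ of (real or complex) Hilbert spaces $H_p$ and bounded linear operators $\delta_p\colon H_p\to H_{p-1}$, with the convention $H_p=0$ and $\delta_p=0$ for $p<0$ and for $p\ge n+1$ (and hence $\delta_0=0$); no condition is imposed on the compositions $\delta_p\delta_{p+1}$. Write $N(\cdot)$ for the null space and $R(\cdot)$ for the range. The sequence $(H,\delta)$ is called a Fredholm chain if the spaces $N(\delta_p)/(N(\delta_p)\cap R(\delta_{p+1}))$ and $R(\delta_{p+1})/(N(\delta_p)\cap R(\delta_{p+1}))$ are finite dimensional for $p=0,\dots,n$, and then its index is $$\operatorname{ind}(H,\delta)=\sum_{p=0}^n(-1)^p\Big(\dim \frac{N(\delta_p)}{N(\delta_p)\cap R(\delta_{p+1})}-\dim \frac{R(\delta_{p+1})}{N(\delta_p)\cap R(\delta_{p+1})}\Big).$$ The dual sequence $(H',\delta')$ is given by $H'_p=H_{n-p}$ and $\delta'_p=\delta^*_{n-p+1}$, that is, $0\to H_0\xrightarrow{\delta_1^*}H_1\to\cdots\to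 H_{n-1}\xrightarrow{\delta_n^*}H_n\to 0$. Theorem 6.4. The sequence $(H,\delta)$ is a Fredholm chain if and only if its dual sequence $(H',\delta')$ is a Fredholm chain. In that case $$\operatorname{ind}(H,\delta)=(-1)^n\operatorname{ind}(H',\delta').$$ -/

import Mathlib

universe u v

/-- A sequence of Hilbert spaces and bounded operators
`0 → H_n → H_{n-1} → ⋯ → H_1 → H_0 → 0`, with spaces indexed by `ℤ` and `H_p = 0` unless
`0 ≤ p ≤ n`. No condition is imposed on the compositions.

The operator `δ_p : H_p → H_{p-1}` is `d i j h` with `i = p`, `j = p - 1`; the proof argument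
`h : i = j + 1` only serves to avoid transports along equalities between indices. Since
`H_p = 0` outside `0 ≤ p ≤ n`, one has `δ_p = 0` for `p ≤ 0` and for `p ≥ n + 1`. -/
structure HilbertSequence (𝕜 : Type v) [RCLike 𝕜] (n : ℕ) where
  /-- The spaces `H_p`. -/
  H : ℤ → Type u
  [normed : ∀ p, NormedAddCommGroup (H p)]
  [inner : ∀ p, InnerProductSpace 𝕜 (H p)]
  [complete : ∀ p, CompleteSpace (H p)]
  /-- The operators: `d p (p - 1) _` is `δ_p`. -/
  d : ∀ i j : ℤ, i = j + 1 → (H i →L[𝕜] H j)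
  subsingleton_of_neg : ∀ p : ℤ, p < 0 → Subsingleton (H p)
  subsingleton_of_gt : ∀ p : ℤ, (n : ℤ) < p → Subsingleton (H p)

namespace HilbertSequence

variable {𝕜 : Type v} [RCLike 𝕜] {n : ℕ}

attribute [instance] HilbertSequence.normed HilbertSequence.inner HilbertSequence.complete

/-- The null space `N(δ_p) ⊆ H_p`. -/
def N (C : HilbertSequence.{u, v} 𝕜 n) (p : ℤ) : Submodule 𝕜 (C.H p) :=
  LinearMap.ker (C.d p (p - 1) (by omega)).toLinearMap

/-- The range `R(δ_{p+1}) ⊆ H_p`. -/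
def R (C : HilbertSequence.{u, v} 𝕜 n) (p : ℤ) : Submodule 𝕜 (C.H p) :=
  LinearMap.range (C.d (p + 1) p rfl).toLinearMap

/-- The quotient `N(δ_p) / (N(δ_p) ∩ R(δ_{p+1}))`. -/
abbrev NQuot (C : HilbertSequence.{u, v} 𝕜 n) (p : ℤ) : Type u :=
  ↥(C.N p) ⧸ (C.N p ⊓ C.R p).submoduleOf (C.N p)

/-- The quotient `R(δ_{p+1}) / (N(δ_p) ∩ R(δ_{p+1}))`. -/
abbrev RQuot (C : HilbertSequence.{u, v} 𝕜 n) (p : ℤ) : Type u :=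
  ↥(C.R p) ⧸ (C.N p ⊓ C.R p).submoduleOf (C.R p)

/-- The sequence is a Fredholm chain: for `p = 0, …, n` both
`N(δ_p) / (N(δ_p) ∩ R(δ_{p+1}))` and `R(δ_{p+1}) / (N(δ_p) ∩ R(δ_{p+1}))` are finite
dimensional. -/
def IsFredholm (C : HilbertSequence.{u, v} 𝕜 n) : Prop :=
  ∀ p : ℕ, p ≤ n → FiniteDimensional 𝕜 (C.NQuot p) ∧ FiniteDimensional 𝕜 (C.RQuot p)

/-- The index of a Fredholm chain. -/
noncomputable def index (C : HilbertSequence.{u, v} 𝕜 n) : ℤ :=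
  ∑ p ∈ Finset.range (n + 1), (-1 : ℤ) ^ p *
    ((Module.finrank 𝕜 (C.NQuot p) : ℤ) - (Module.finrank 𝕜 (C.RQuot p) : ℤ))

/-- The dual sequence `H'_p = H_{n-p}`, `δ'_p = (δ_{n-p+1})^*`, that is
`0 → H_0 → H_1 → ⋯ → H_{n-1} → H_n → 0` with the adjoint operators. -/
noncomputable def dual (C : HilbertSequence.{u, v} 𝕜 n) : HilbertSequence.{u, v} 𝕜 n where
  H p := C.H (n - p)
  d i j h := ContinuousLinearMap.adjoint (C.d (n - j) (n - i) (by omega))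
  subsingleton_of_neg p hp := C.subsingleton_of_gt _ (by omega)
  subsingleton_of_gt p hp := C.subsingleton_of_neg _ (by omega)

end HilbertSequence

/-! Finite-dimensionality forces closedness: `N + R` is the closed space `N` plus a
finite-dimensional space, and `R` is then closed as an operator range with a finite-dimensional
complement in `N + R` (`isClosed_range_of_isClosed_sup`). By the closed range theorem the dual
sequence has `N' = Rᗮ` and `R' = Nᗮ` inside the same space `H_{n-q}`. Both `N / (N ⊓ R)` and `Rᗮ /
(Rᗮ ⊓ Nᗮ)` are copies of `Rᗮ ⊓ (N ⊔ R)`, and symmetrically for `R`. So the quotients agree degree by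
degree under `p = n - q`, which costs only the sign `(-1)^n`. -/

namespace Submodule

section Algebra

variable {K V : Type*} [Field K] [AddCommGroup V] [Module K V]

/-- If `L ≤ A` is a complement of `A ⊓ B` in `A`, then `A / (A ⊓ B) ≃ L`. -/
theorem nonempty_quotient_inf_equiv {A B L : Submodule K V} (hL : L ≤ A) (hd : Disjoint B L)
    (hs : A ≤ B ⊔ L) : Nonempty ((↥A ⧸ (A ⊓ B).submoduleOf A) ≃ₗ[K] L) := by
  have hc : IsCompl ((A ⊓ B).submoduleOf A) (L.submoduleOf A) := by
    constructor
    · rw [disjoint_def]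
      rintro ⟨x, hx⟩ hB hL'
      exact Subtype.ext (disjoint_def.1 hd x hB.2 hL')
    · rw [codisjoint_iff, eq_top_iff]
      rintro ⟨x, hx⟩ -
      obtain ⟨b, hb, l, hl, rfl⟩ := mem_sup.1 (hs hx)
      have hbA : b ∈ A := by simpa using A.sub_mem hx (hL hl)
      exact mem_sup.2 ⟨⟨b, hbA⟩, ⟨hbA, hb⟩, ⟨l, hL hl⟩, hl, rfl⟩
  exact ⟨(quotientEquivOfIsCompl _ _ hc).trans (submoduleOfEquivOfLe hL)⟩

/-- If `A ⊓ B` has finite codimension in `A`, then `A ⊔ B` is the direct sum of `B` and a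
finite-dimensional subspace. -/
theorem exists_finiteDimensional_disjoint_sup_eq (A B : Submodule K V)
    [FiniteDimensional K (↥A ⧸ (A ⊓ B).submoduleOf A)] :
    ∃ L : Submodule K V, FiniteDimensional K L ∧ Disjoint B L ∧ B ⊔ L = A ⊔ B := by
  obtain ⟨L, hd, hs⟩ := IsModularLattice.exists_disjoint_and_sup_eq (inf_le_left : A ⊓ B ≤ A)
  have hL : L ≤ A := hs ▸ le_sup_right
  have hd' : Disjoint B L := by
    rw [disjoint_def] at hd ⊢
    exact fun x hB hx => hd x ⟨hL hx, hB⟩ hx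
  have hA : A ≤ B ⊔ L := hs.ge.trans (sup_le_sup_right inf_le_right _)
  obtain ⟨e⟩ := nonempty_quotient_inf_equiv hL hd' hA
  exact ⟨L, e.finiteDimensional, hd',
    le_antisymm (sup_le le_sup_right (hL.trans le_sup_left)) (sup_le hA le_sup_left)⟩

end Algebra

section Hilbert

variable {𝕜 E : Type*} [RCLike 𝕜] [NormedAddCommGroup E] [InnerProductSpace 𝕜 E]

theorem isClosed_sup_of_finiteDimensional_quotient_inf {A B : Submodule 𝕜 E}
    (hA : IsClosed (A : Set E)) (hfin : FiniteDimensional 𝕜 (↥B ⧸ (A ⊓ B).submoduleOf B)) :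
    IsClosed ((A ⊔ B : Submodule 𝕜 E) : Set E) := by
  rw [inf_comm] at hfin
  obtain ⟨L, _, -, hL⟩ := exists_finiteDimensional_disjoint_sup_eq B A
  rw [sup_comm, ← hL]
  exact isClosed_sup_finiteDimensional A L hA

/-- For closed `B` and `A ⊔ B` in a Hilbert space, `A / (A ⊓ B) ≃ Bᗮ / (Bᗮ ⊓ Aᗮ)`: both are
isomorphic to `Bᗮ ⊓ (A ⊔ B)`. -/
theorem nonempty_quotient_inf_equiv_orthogonal [CompleteSpace E] {A B : Submodule 𝕜 E}
    (hB : IsClosed (B : Set E)) (hAB : IsClosed ((A ⊔ B : Submodule 𝕜 E) : Set E)) :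
    Nonempty ((↥A ⧸ (A ⊓ B).submoduleOf A) ≃ₗ[𝕜] (↥Bᗮ ⧸ (Bᗮ ⊓ Aᗮ).submoduleOf Bᗮ)) := by
  have := hB.completeSpace_coe
  have := hAB.completeSpace_coe
  have hM : Bᗮ ⊓ Aᗮ = (A ⊔ B)ᗮ := by rw [inf_comm, inf_orthogonal]
  obtain ⟨e₁⟩ : Nonempty ((↥(A ⊔ B) ⧸ ((A ⊔ B) ⊓ B).submoduleOf (A ⊔ B)) ≃ₗ[𝕜]
      ↥(Bᗮ ⊓ (A ⊔ B))) :=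
    nonempty_quotient_inf_equiv inf_le_right (B.orthogonal_disjoint.mono_right inf_le_left)
      (sup_orthogonal_inf_of_hasOrthogonalProjection le_sup_right).ge
  obtain ⟨e₂⟩ : Nonempty ((↥Bᗮ ⧸ (Bᗮ ⊓ (A ⊔ B)ᗮ).submoduleOf Bᗮ) ≃ₗ[𝕜] ↥(Bᗮ ⊓ (A ⊔ B))) := by
    refine nonempty_quotient_inf_equiv inf_le_left
      ((A ⊔ B).orthogonal_disjoint.symm.mono_right inf_le_right) ?_
    have h := sup_orthogonal_inf_of_hasOrthogonalProjection
      (orthogonal_le (le_sup_right : B ≤ A ⊔ B))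
    rw [orthogonal_orthogonal, inf_comm] at h
    exact h.ge
  have h₁ : ((A ⊔ B) ⊓ B).submoduleOf (A ⊔ B) = comap (A ⊔ B).subtype B := by
    rw [inf_eq_right.2 le_sup_right, submoduleOf]
  have h₂ : (Bᗮ ⊓ (A ⊔ B)ᗮ).submoduleOf Bᗮ = (Bᗮ ⊓ Aᗮ).submoduleOf Bᗮ := by
    rw [← hM, ← inf_assoc, inf_idem]
  exact ⟨(LinearMap.quotientInfEquivSupQuotient A B).trans
    ((quotEquivOfEq _ _ h₁).symm.trans (e₁.trans (e₂.symm.trans (quotEquivOfEq _ _ h₂))))⟩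

end Hilbert

end Submodule

/-! ### Closed ranges and adjoints. -/

namespace ContinuousLinearMap

variable {𝕜 E F : Type*} [RCLike 𝕜] [NormedAddCommGroup E] [InnerProductSpace 𝕜 E]
  [CompleteSpace E] [NormedAddCommGroup F] [InnerProductSpace 𝕜 F] [CompleteSpace F]

/-- A range that has finite codimension in a closed subspace is closed. -/
theorem isClosed_range_of_isClosed_sup (T : E →L[𝕜] F) (L : Submodule 𝕜 F)
    [FiniteDimensional 𝕜 L] (hd : Disjoint T.range L)
    (hc : IsClosed ((T.range ⊔ L : Submodule 𝕜 F) : Set F)) : IsClosed (T.range : Set F) := by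
  have := hc.completeSpace_coe
  have : CompleteSpace T.ker := T.isClosed_ker.completeSpace_coe
  set M := T.range ⊔ L with hM
  -- Restricting to `T.kerᗮ` makes the operator injective without changing its range.
  have hrange : (T ∘L T.kerᗮ.subtypeL).range = T.range := by
    refine le_antisymm (LinearMap.range_comp_le_range _ _) ?_
    rintro _ ⟨x, rfl⟩
    obtain ⟨k, hk, z, hz, rfl⟩ := Submodule.mem_sup.1
      (T.ker.sup_orthogonal_of_hasOrthogonalProjection ▸ Submodule.mem_top : x ∈ T.ker ⊔ T.kerᗮ)
    exact ⟨⟨z, hz⟩, by simpa using hk⟩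
  have hker : (T ∘L T.kerᗮ.subtypeL).ker = ⊥ := by
    rw [LinearMap.ker_eq_bot']
    rintro ⟨x, hx⟩ h
    exact Subtype.ext (Submodule.disjoint_def.1 T.ker.orthogonal_disjoint x h hx)
  -- `Mᗮ ⊔ L` is a closed complement of the range in all of `F`, since `L` is finite dimensional.
  have hcompl : IsCompl (T ∘L T.kerᗮ.subtypeL).range (Mᗮ ⊔ L) := by
    rw [hrange]
    constructor
    · rw [Submodule.disjoint_def]
      intro x hx hx'
      obtain ⟨m, hm, l, hl, rfl⟩ := Submodule.mem_sup.1 hx'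
      have hmM : m ∈ M := by
        simpa using M.sub_mem (le_sup_left (b := L) hx) (le_sup_right (a := T.range) hl)
      obtain rfl := Submodule.disjoint_def.1 M.orthogonal_disjoint m hmM hm
      exact Submodule.disjoint_def.1 hd _ hx (by simpa using hl)
    · rw [codisjoint_iff, sup_left_comm, ← hM, sup_comm,
        Submodule.sup_orthogonal_of_hasOrthogonalProjection]
  rw [← hrange]
  exact closed_complemented_range_of_isCompl_of_ker_eq_bot _ _ hcompl
    (Submodule.isClosed_sup_finiteDimensional _ _ M.isClosed_orthogonal) hker

/-- If the range of an operator is closed, so is the range of its adjoint. -/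
theorem isClosed_range_adjoint (T : E →L[𝕜] F) (hT : IsClosed (T.range : Set F)) :
    IsClosed (T.adjoint.range : Set E) := by
  have := hT.completeSpace_coe
  obtain ⟨c, hc, h⟩ := exists_preimage_norm_le T.rangeRestrict T.surjective_rangeRestrict
  -- The open mapping theorem supplies `c`; pairing the adjoint at `y` with a preimage of `y` of
  -- norm at most `c * ‖y‖` bounds it below.
  have hanti : AntilipschitzWith c.toNNReal (T.rangeRestrict).adjoint := by
    refine AddMonoidHomClass.antilipschitz_of_bound _ fun y => ?_
    rw [Real.coe_toNNReal c hc.le]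
    obtain ⟨x, hx, hxy⟩ := h y
    rcases (norm_nonneg y).eq_or_lt with hy | hy
    · rw [← hy]; positivity
    refine le_of_mul_le_mul_right ?_ hy
    calc ‖y‖ * ‖y‖ = ‖inner 𝕜 ((T.rangeRestrict).adjoint y) x‖ := by
          rw [adjoint_inner_left, hx, inner_self_eq_norm_sq_to_K, norm_pow,
            norm_algebraMap', norm_norm, sq]
      _ ≤ ‖(T.rangeRestrict).adjoint y‖ * ‖x‖ := norm_inner_le_norm _ _
      _ ≤ ‖(T.rangeRestrict).adjoint y‖ * (c * ‖y‖) := by gcongr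
      _ = c * ‖(T.rangeRestrict).adjoint y‖ * ‖y‖ := by ring
  have hrange : T.adjoint.range = (T.rangeRestrict).adjoint.range := by
    apply le_antisymm
    · have hT' : T = T.range.subtypeL ∘L T.rangeRestrict := rfl
      conv_lhs => rw [hT', adjoint_comp]
      exact LinearMap.range_comp_le_range _ _
    · rintro _ ⟨y, rfl⟩
      refine ⟨y, ext_inner_right 𝕜 fun x => ?_⟩
      simp only [coe_coe, adjoint_inner_left]
      rfl
  rw [hrange]
  exact hanti.isClosed_range (T.rangeRestrict).adjoint.uniformContinuous

theorem isClosed_range_adjoint_iff (T : E →L[𝕜] F) :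
    IsClosed (T.adjoint.range : Set E) ↔ IsClosed (T.range : Set F) :=
  ⟨fun h => by simpa using T.adjoint.isClosed_range_adjoint h, T.isClosed_range_adjoint⟩

end ContinuousLinearMap

/-! ### Duality for Fredholm chains. -/

namespace HilbertSequence

variable {𝕜 : Type v} [RCLike 𝕜] {n : ℕ} (C : HilbertSequence.{u, v} 𝕜 n)

theorem range_d_eq_R {i j : ℤ} (h : i = j + 1) : (C.d i j h).range = C.R j := by
  subst h; rfl

theorem ker_d_eq_N {i j : ℤ} (h : i = j + 1) : (C.d i j h).ker = C.N i := by
  obtain rfl : j = i - 1 := by omega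
  rfl

theorem isClosed_N (p : ℤ) : IsClosed (C.N p : Set (C.H p)) :=
  (C.d p (p - 1) (by omega)).isClosed_ker

variable {C}

theorem IsFredholm.finiteDimensional (hC : C.IsFredholm) (p : ℤ) :
    FiniteDimensional 𝕜 (C.NQuot p) ∧ FiniteDimensional 𝕜 (C.RQuot p) := by
  by_cases hp : 0 ≤ p ∧ p ≤ n
  · lift p to ℕ using hp.1
    exact hC p (by omega)
  · have : Subsingleton (C.H p) := by
      by_cases h0 : p < 0
      · exact C.subsingleton_of_neg p h0
      · exact C.subsingleton_of_gt p (by omega)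
    exact ⟨inferInstance, inferInstance⟩

theorem IsFredholm.isClosed_sup (hC : C.IsFredholm) (p : ℤ) :
    IsClosed ((C.N p ⊔ C.R p : Submodule 𝕜 (C.H p)) : Set (C.H p)) :=
  Submodule.isClosed_sup_of_finiteDimensional_quotient_inf (C.isClosed_N p)
    (hC.finiteDimensional p).2

theorem IsFredholm.isClosed_R (hC : C.IsFredholm) (p : ℤ) :
    IsClosed (C.R p : Set (C.H p)) := by
  have := (hC.finiteDimensional p).1
  obtain ⟨L, _, hd, hs⟩ :=
    Submodule.exists_finiteDimensional_disjoint_sup_eq (C.N p) (C.R p)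
  have hc := hC.isClosed_sup p
  rw [← hs] at hc
  exact (C.d (p + 1) p rfl).isClosed_range_of_isClosed_sup L hd hc

variable (C)

theorem dual_N (q : ℤ) :
    (C.dual.N q : Submodule 𝕜 (C.H (n - q))) = (C.R (n - q))ᗮ := by
  rw [← C.range_d_eq_R (show (n : ℤ) - (q - 1) = n - q + 1 by omega),
    ContinuousLinearMap.orthogonal_range]
  rfl

theorem isClosed_dual_R_iff (q : ℤ) :
    IsClosed (C.dual.R q : Set (C.dual.H q)) ↔
      IsClosed (C.R (n - (q + 1)) : Set (C.H (n - (q + 1)))) := by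
  rw [← C.range_d_eq_R (show (n : ℤ) - q = n - (q + 1) + 1 by omega),
    ← ContinuousLinearMap.isClosed_range_adjoint_iff]
  rfl

theorem dual_R (q : ℤ) (h : IsClosed (C.dual.R q : Set (C.dual.H q))) :
    (C.dual.R q : Submodule 𝕜 (C.H (n - q))) = (C.N (n - q))ᗮ := by
  rw [← C.ker_d_eq_N (show (n : ℤ) - q = n - (q + 1) + 1 by omega),
    ContinuousLinearMap.orthogonal_ker]
  exact (IsClosed.submodule_topologicalClosure_eq h).symm

variable {C}

theorem IsFredholm.nonempty_equiv_dual (hC : C.IsFredholm) (q : ℤ) :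
    Nonempty (C.NQuot (n - q) ≃ₗ[𝕜] C.dual.NQuot q) ∧
      Nonempty (C.RQuot (n - q) ≃ₗ[𝕜] C.dual.RQuot q) := by
  have hsup := hC.isClosed_sup (n - q)
  have hN := C.dual_N q
  have hR := C.dual_R q ((C.isClosed_dual_R_iff q).2 (hC.isClosed_R _))
  -- Arbitrary submodules of `C.H (n - q)` allow `subst`; those of `C.dual` live there only after
  -- unfolding `dual`.
  have key {N R N' R' : Submodule 𝕜 (C.H (n - q))} (hN : IsClosed (N : Set (C.H (n - q))))
      (hR : IsClosed (R : Set (C.H (n - q))))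
      (hs : IsClosed ((N ⊔ R : Submodule 𝕜 (C.H (n - q))) : Set (C.H (n - q))))
      (hN' : N' = Rᗮ) (hR' : R' = Nᗮ) :
      Nonempty ((↥N ⧸ (N ⊓ R).submoduleOf N) ≃ₗ[𝕜] (↥N' ⧸ (N' ⊓ R').submoduleOf N')) ∧
      Nonempty ((↥R ⧸ (N ⊓ R).submoduleOf R) ≃ₗ[𝕜] (↥R' ⧸ (N' ⊓ R').submoduleOf R')) := by
    subst hN' hR'
    refine ⟨Submodule.nonempty_quotient_inf_equiv_orthogonal hR hs, ?_⟩
    rw [inf_comm N R, inf_comm Rᗮ Nᗮ]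
    exact Submodule.nonempty_quotient_inf_equiv_orthogonal hN (by rwa [sup_comm])
  exact key (C.isClosed_N _) (hC.isClosed_R _) hsup hN hR

theorem IsFredholm.dual (hC : C.IsFredholm) : C.dual.IsFredholm := by
  intro q _
  obtain ⟨⟨e⟩, ⟨f⟩⟩ := hC.nonempty_equiv_dual q
  obtain ⟨_, _⟩ := hC.finiteDimensional (n - q)
  exact ⟨e.finiteDimensional, f.finiteDimensional⟩

/-- The double dual has spaces `C.H (n - (n - p))`, so rather than dualizing twice, the orthogonal
equivalence is applied to `Rᗮ` and `Nᗮ`; closedness of `N` and `R` removes the double complements.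
-/
theorem IsFredholm.of_dual (hC : C.dual.IsFredholm) : C.IsFredholm := by
  have hcl (p : ℤ) : IsClosed (C.R p : Set (C.H p)) := by
    have h := (C.isClosed_dual_R_iff (n - p - 1)).1 (hC.isClosed_R _)
    rwa [show (n : ℤ) - (n - p - 1 + 1) = p by omega] at h
  have key (q : ℤ) : FiniteDimensional 𝕜 (C.NQuot (n - q)) ∧
      FiniteDimensional 𝕜 (C.RQuot (n - q)) := by
    have aux {N R N' R' : Submodule 𝕜 (C.H (n - q))} (hN : IsClosed (N : Set (C.H (n - q))))
        (hR : IsClosed (R : Set (C.H (n - q))))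
        (hs : IsClosed ((N' ⊔ R' : Submodule 𝕜 (C.H (n - q))) : Set (C.H (n - q))))
        (hN' : N' = Rᗮ) (hR' : R' = Nᗮ)
        (hfN : FiniteDimensional 𝕜 (↥N' ⧸ (N' ⊓ R').submoduleOf N'))
        (hfR : FiniteDimensional 𝕜 (↥R' ⧸ (N' ⊓ R').submoduleOf R')) :
        FiniteDimensional 𝕜 (↥N ⧸ (N ⊓ R).submoduleOf N) ∧
        FiniteDimensional 𝕜 (↥R ⧸ (N ⊓ R).submoduleOf R) := by
      have := hN.completeSpace_coe
      have := hR.completeSpace_coe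
      subst hN' hR'
      obtain ⟨e⟩ := Submodule.nonempty_quotient_inf_equiv_orthogonal N.isClosed_orthogonal hs
      rw [inf_comm] at hfR
      rw [sup_comm] at hs
      obtain ⟨f⟩ := Submodule.nonempty_quotient_inf_equiv_orthogonal R.isClosed_orthogonal hs
      rw [Submodule.orthogonal_orthogonal, Submodule.orthogonal_orthogonal] at e f
      rw [inf_comm R N] at f
      exact ⟨e.finiteDimensional, f.finiteDimensional⟩
    exact aux (C.isClosed_N _) (hcl _) (hC.isClosed_sup q) (C.dual_N q)
      (C.dual_R q (hC.isClosed_R q)) (hC.finiteDimensional q).1 (hC.finiteDimensional q).2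
  intro p _
  have h := key (n - p)
  rwa [sub_sub_cancel] at h

theorem IsFredholm.index_eq (hC : C.IsFredholm) :
    C.index = (-1 : ℤ) ^ n * C.dual.index := by
  rw [index, index, Finset.mul_sum, ← Finset.sum_range_reflect]
  refine Finset.sum_congr rfl fun q hq => ?_
  have hqn : q ≤ n := by simpa [Nat.lt_succ_iff] using hq
  obtain ⟨⟨e⟩, ⟨f⟩⟩ := hC.nonempty_equiv_dual q
  rw [← e.finrank_eq, ← f.finrank_eq, show n + 1 - 1 - q = n - q by omega,
    Nat.cast_sub hqn, ← mul_assoc]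
  congr 1
  -- With `n = q + k`, the sign identity is `(-1)^k = (-1)^(q + k) * (-1)^q`.
  obtain ⟨k, rfl⟩ := Nat.exists_eq_add_of_le hqn
  rw [Nat.add_sub_cancel_left, pow_add, mul_right_comm, ← mul_pow]
  simp

end HilbertSequence

theorem theorem6p4 {𝕜 : Type v} [RCLike 𝕜] {n : ℕ} (C : HilbertSequence.{u, v} 𝕜 n) :
    (C.IsFredholm ↔ C.dual.IsFredholm) ∧
      (C.IsFredholm → C.index = (-1 : ℤ) ^ n * C.dual.index) :=
  ⟨⟨fun h => h.dual, fun h => h.of_dual⟩, fun h => h.index_eq⟩
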